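/- Let $n\ge 1$ and let $\Phi=B_n$ be realized in $V=\mathbb{R}^n$ with its standard inner product: the roots are $\pm e_i\pm e_j$ ($i<j$) and $\pm e_i$, the positive roots $\Phi^+$ are $e_i\pm e_j$ ($i<j$) and $e_i$, and the simple roots are $\alpha_i=e_i-e_{i+1}$ ($1\le i<n$) and $\alpha_n=e_n$. Write $\alpha^\vee=2\alpha/\langle\alpha,\alpha\rangle$. Let $Q=\mathbb{Z}\Phi$ be the root lattice, $P=\{v\in V:\langle v,\alpha^\vee\rangle\in\mathbb{Z}\ \text{for all } \alpha\in\Phi\}$ the weight lattice, $W$ the Weyl group, $\omega_1,\dots,\omega_n$ the fundamental weights, defined by $\langle\omega_i,\alpha_j^\vee\rangle=\delta_{ij}$, and $\rho=\omega_1+\cdots+\omega_n$. For $\lambda\in P$ let $\Pi(\lambda)$ be the convex hull of $W\lambda$, let $\Pi^{Q}(\lambda)=\{\mu\in\Pi(\lambda):\lambda-\mu\in Q\}$, and let $\Pi^{\circ,Q}(\lambda)$ be the intersection of the topological interior of $\Pi(\lambda)$ with $\lambda+Q$. A nonzero weight $\lambda\in P$ with $\langle\lambda,\alpha_i^\vee\rangle\ge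 0$ for all $i$ is called minuscule if $\Pi^Q(\lambda)=W\lambda$; let $\Omega_m^0$ consist of $0$ and the minuscule weights. A central-firing move replaces $\lambda\in P$ by $\lambda+\alpha$, where $\alpha\in\Phi^+$ and $\langle\lambda,\alpha^\vee\rangle=0$. A weight $\lambda\in P$ is called connected if the vectors $\lambda-\mu$, where $\mu$ ranges over all weights that can be reached from $\lambda$ by finitely many (possibly zero) central-firing moves, span $V$ over $\mathbb{R}$. Then for every connected weight $\lambda\in P$ there is an $\omega\in\Omega_m^0$, which moreover is $0$ or $\omega_n$, such that $\lambda\in\Pi^{\circ,Q}(\rho+\omega)$. -/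

import Mathlib

noncomputable section

namespace CentralFiring

open scoped InnerProductSpace

section General

variable {V : Type*} [NormedAddCommGroup V] [InnerProductSpace ℝ V]

/-- The coroot `α^∨ = 2 α / ⟨α, α⟩` of a nonzero vector `α`. -/
def coroot (α : V) : V := (2 / ⟪α, α⟫_ℝ) • α

/-- The reflection `s_α(v) = v - ⟨v, α^∨⟩ α`, i.e. the orthogonal reflection in the hyperplane
orthogonal to `α`. -/
def rootReflection (α : V) : V ≃ₗᵢ[ℝ] V := (Submodule.span ℝ {α})ᗮ.reflection

theorem rootReflection_apply (α v : V) :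
    rootReflection α v = v - ⟪v, coroot α⟫_ℝ • α := by
  rw [rootReflection, Submodule.reflection_orthogonal_apply,
    Submodule.reflection_singleton_apply, coroot, inner_smul_right, real_inner_comm α v,
    real_inner_self_eq_norm_sq]
  simp only [RCLike.ofReal_real_eq_id, id_eq, neg_sub]
  rw [← Nat.cast_smul_eq_nsmul ℝ 2, smul_smul]
  congr 2
  push_cast
  ring

/-- The Weyl group: the group generated by the reflections `s_α`, `α ∈ Φ`. -/
def weylGroup (Φ : Set V) : Subgroup (V ≃ₗᵢ[ℝ] V) :=
  Subgroup.closure (rootReflection '' Φ)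

/-- The orbit of `v` under the Weyl group. -/
def weylOrbit (Φ : Set V) (v : V) : Set V := {x | ∃ w ∈ weylGroup Φ, w v = x}

/-- The root lattice `Q`: all integer combinations of roots. -/
def rootLattice (Φ : Set V) : AddSubgroup V := AddSubgroup.closure Φ

/-- The weight lattice `P`: all `v` such that `⟨v, α^∨⟩` is an integer for each root `α`. -/
def weightLattice (Φ : Set V) : Set V := {v | ∀ α ∈ Φ, ∃ m : ℤ, ⟪v, coroot α⟫_ℝ = m}

/-- Dominance with respect to a family of simple roots. -/
def IsDominant {ι : Type*} (Δ : ι → V) (v : V) : Prop := ∀ i, 0 ≤ ⟪v, coroot (Δ i)⟫_ℝ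

/-- The permutohedron `Π(v)`: the convex hull of the Weyl group orbit of `v`. -/
def permutohedron (Φ : Set V) (v : V) : Set V := convexHull ℝ (weylOrbit Φ v)

/-- The lattice points `Π^Q(v)` of the permutohedron. -/
def permutohedronPoints (Φ : Set V) (v : V) : Set V :=
  {x | x ∈ permutohedron Φ v ∧ v - x ∈ rootLattice Φ}

/-- The lattice points `Π^{∘,Q}(v) = Π^∘(v) ∩ (Q + v)` of the interior of the permutohedron. -/
def permutohedronInteriorPoints (Φ : Set V) (v : V) : Set V :=
  {x | x ∈ interior (permutohedron Φ v) ∧ x - v ∈ rootLattice Φ}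

/-- A nonzero dominant weight is minuscule if the only lattice points of its permutohedron are
the points of its Weyl group orbit. -/
def IsMinuscule {ι : Type*} (Φ : Set V) (Δ : ι → V) (v : V) : Prop :=
  v ≠ 0 ∧ v ∈ weightLattice Φ ∧ IsDominant Δ v ∧ permutohedronPoints Φ v = weylOrbit Φ v

/-- `Ω_m^0`: the minuscule weights together with zero. -/
def zeroOrMinuscule {ι : Type*} (Φ : Set V) (Δ : ι → V) : Set V :=
  {v | v = 0 ∨ IsMinuscule Φ Δ v}

/-- A central-firing move: `v → v + α` for a positive root `α` with `⟨v, α^∨⟩ = 0`. -/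
def CentralFires (Φpos : Set V) (v v' : V) : Prop :=
  ∃ α ∈ Φpos, ⟪v, coroot α⟫_ℝ = 0 ∧ v' = v + α

/-- The firing span at `v`: the span of all `v - μ`, where `μ` is reachable from `v` by finitely
many central-firing moves. -/
def firingSpan (Φpos : Set V) (v : V) : Submodule ℝ V :=
  Submodule.span ℝ {x | ∃ μ, Relation.ReflTransGen (CentralFires Φpos) v μ ∧ x = v - μ}

/-- `v` is connected if its firing span is the whole space. -/
def IsConnectedWeight (Φpos : Set V) (v : V) : Prop := firingSpan Φpos v = ⊤

end General

section TypeB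

/-- The standard basis vector `e_i` of `ℝⁿ`. -/
abbrev e {n : ℕ} (i : Fin n) : EuclideanSpace ℝ (Fin n) := EuclideanSpace.single i (1 : ℝ)

/-- The roots of `B_n`: `± e_i ± e_j` for `i < j`, and `± e_i`. -/
def rootsB (n : ℕ) : Set (EuclideanSpace ℝ (Fin n)) :=
  {v | (∃ i j : Fin n, i < j ∧
      (v = e i + e j ∨ v = e i - e j ∨ v = -e i + e j ∨ v = -e i - e j)) ∨
    ∃ i : Fin n, v = e i ∨ v = -e i}

/-- The positive roots of `B_n`: `e_i ± e_j` for `i < j`, and `e_i`. -/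
def posRootsB (n : ℕ) : Set (EuclideanSpace ℝ (Fin n)) :=
  {v | (∃ i j : Fin n, i < j ∧ (v = e i + e j ∨ v = e i - e j)) ∨ ∃ i : Fin n, v = e i}

/-- The simple roots of `B_n`: `e_i - e_{i+1}` for all `i` but the last one, and `e_i` for the
last `i`. -/
def simpleRootB (n : ℕ) (i : Fin n) : EuclideanSpace ℝ (Fin n) :=
  if h : (i : ℕ) + 1 < n then e i - e ⟨i + 1, h⟩ else e i

/-- The fundamental weights of `B_n`: `e_1 + ⋯ + e_i` for `i < n`, and
`(e_1 + ⋯ + e_n) / 2` for `i = n` (here the indices start from `0`). -/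
def fundamentalWeightB (n : ℕ) (i : Fin n) : EuclideanSpace ℝ (Fin n) :=
  if (i : ℕ) + 1 < n then ∑ j ∈ Finset.Iic i, e j else (1 / 2 : ℝ) • ∑ j, e j

theorem inner_coroot_simpleRootB (n : ℕ) (v : EuclideanSpace ℝ (Fin n)) (j : Fin n) :
    ⟪v, coroot (simpleRootB n j)⟫_ℝ =
      if h : (j : ℕ) + 1 < n then v j - v ⟨j + 1, h⟩ else 2 * v j := by
  unfold simpleRootB coroot
  split_ifs with h
  · have hne : j ≠ ⟨j + 1, h⟩ := by
      intro h'
      have := congrArg Fin.val h'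
      simp at this
    have hself : ⟪e j - e ⟨j + 1, h⟩, e j - e ⟨j + 1, h⟩⟫_ℝ = 2 := by
      simp only [inner_sub_right, EuclideanSpace.inner_single_right]
      simp [hne, hne.symm]
      norm_num
    rw [hself]
    simp [inner_sub_right, EuclideanSpace.inner_single_right]
  · simp [inner_smul_right, EuclideanSpace.inner_single_right]

theorem fundamentalWeightB_apply (n : ℕ) (i k : Fin n) :
    fundamentalWeightB n i k =
      if (i : ℕ) + 1 < n then (if k ≤ i then 1 else 0) else 1 / 2 := by
  unfold fundamentalWeightB
  split_ifs <;> simp_all [Pi.single_apply]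

/-- The vectors `fundamentalWeightB n i` are the fundamental weights, i.e. the basis dual to the
simple coroots. -/
theorem eq_fundamentalWeightB_iff (n : ℕ) (i : Fin n) (v : EuclideanSpace ℝ (Fin n)) :
    v = fundamentalWeightB n i ↔
      ∀ j, ⟪v, coroot (simpleRootB n j)⟫_ℝ = if i = j then 1 else 0 := by
  have dual : ∀ j, ⟪fundamentalWeightB n i, coroot (simpleRootB n j)⟫_ℝ =
      if i = j then 1 else 0 := by
    intro j
    rw [inner_coroot_simpleRootB]
    simp only [fundamentalWeightB_apply, Fin.le_def, Fin.ext_iff]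
    split_ifs <;> first | omega | norm_num
  constructor
  · rintro rfl
    exact dual
  · intro hv
    have key : ∀ m : ℕ, ∀ k : Fin n, (k : ℕ) + m + 1 = n → v k = fundamentalWeightB n i k := by
      intro m
      induction m with
      | zero =>
        intro k hk
        have h := (hv k).trans (dual k).symm
        rw [inner_coroot_simpleRootB, inner_coroot_simpleRootB, dif_neg (by omega),
          dif_neg (by omega)] at h
        linarith
      | succ m ih =>
        intro k hk
        have h := (hv k).trans (dual k).symm
        have hlt : (k : ℕ) + 1 < n := by omega
        rw [inner_coroot_simpleRootB, inner_coroot_simpleRootB, dif_pos hlt, dif_pos hlt] at h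
        have := ih ⟨k + 1, hlt⟩ (by simp only; omega)
        linarith
    ext k
    exact key (n - 1 - k) k (by omega)

/-- The Weyl vector `ρ` of `B_n`: the sum of the fundamental weights. -/
def weylVectorB (n : ℕ) : EuclideanSpace ℝ (Fin n) := ∑ i, fundamentalWeightB n i

end TypeB

end CentralFiring

end

noncomputable section

namespace CentralFiring

open scoped InnerProductSpace

/-! ### Roots, coroots and the two lattices in coordinates. -/

section Coordinates

variable {n : ℕ}

/-! A weight has all coordinates in `ℤ + c` with `c = 0` or `c = 1/2`, and `(n - c, …, 1 - c)` is `ρ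
+ ω_n` or `ρ` accordingly. The permutohedron of this point is cut out by the inequalities `⟨σ, x⟩ ≤`
(sum of its `|σ|` largest entries), `σ` running over the sign vectors in `{-1, 0, 1}ⁿ`; `excess`
measures their violation.

The key is `exists_excess_ge_of_fires`: if `x` is orthogonal to a positive root `α`, every `σ` is
beaten by some `σ'` whose excess at `x` is larger by at least `|⟨σ, α⟩|`. Hence a maximizer `τ`
satisfies `⟨τ, α⟩ = 0`, and since firing `α` changes the excess of `σ` by `⟨σ, α⟩`, `τ` remains a
maximizer at `x + α`. So `τ` is orthogonal to the whole firing span. If `x` is connected, `τ = 0` is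
the only maximizer; its excess is `0`, so every other excess is negative. These strict inequalities
put `x` in the interior, by separation and Abel summation (`exists_signedPerm_ge`). -/

theorem inner_coroot_single (x : EuclideanSpace ℝ (Fin n)) (i : Fin n) :
    ⟪x, coroot (e i)⟫_ℝ = 2 * x i := by
  simp [coroot, inner_smul_right, EuclideanSpace.inner_single_right]

theorem coroot_neg {V : Type*} [NormedAddCommGroup V] [InnerProductSpace ℝ V] (α : V) :
    coroot (-α) = -coroot α := by
  simp [coroot]

theorem inner_coroot_add (x : EuclideanSpace ℝ (Fin n)) {i j : Fin n} (h : i ≠ j) :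
    ⟪x, coroot (e i + e j)⟫_ℝ = x i + x j := by
  have hself : ⟪e i + e j, e i + e j⟫_ℝ = 2 := by
    simp only [inner_add_right, EuclideanSpace.inner_single_right]
    simp [h, h.symm]
    norm_num
  rw [coroot, hself]
  simp [inner_add_right, EuclideanSpace.inner_single_right]

theorem inner_coroot_sub (x : EuclideanSpace ℝ (Fin n)) {i j : Fin n} (h : i ≠ j) :
    ⟪x, coroot (e i - e j)⟫_ℝ = x i - x j := by
  have hself : ⟪e i - e j, e i - e j⟫_ℝ = 2 := by
    simp only [inner_sub_right, EuclideanSpace.inner_single_right]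
    simp [h, h.symm]
    norm_num
  rw [coroot, hself]
  simp [inner_sub_right, EuclideanSpace.inner_single_right]

theorem inner_coroot_neg_add (x : EuclideanSpace ℝ (Fin n)) {i j : Fin n} (h : i ≠ j) :
    ⟪x, coroot (-e i + e j)⟫_ℝ = -x i + x j := by
  rw [neg_add_eq_sub, inner_coroot_sub x h.symm]
  ring

theorem inner_coroot_neg_sub (x : EuclideanSpace ℝ (Fin n)) {i j : Fin n} (h : i ≠ j) :
    ⟪x, coroot (-e i - e j)⟫_ℝ = -x i - x j := by
  rw [← neg_add', coroot_neg, inner_neg_right, inner_coroot_add x h]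
  ring

/-- All coordinates of `x` lie in `ℤ + c`. -/
def IsIntegralShift (c : ℝ) (x : EuclideanSpace ℝ (Fin n)) : Prop := ∀ i, ∃ m : ℤ, x i = m + c

theorem IsIntegralShift.add {c d : ℝ} {x y : EuclideanSpace ℝ (Fin n)} (hx : IsIntegralShift c x)
    (hy : IsIntegralShift d y) : IsIntegralShift (c + d) (x + y) := by
  intro i
  obtain ⟨a, ha⟩ := hx i
  obtain ⟨b, hb⟩ := hy i
  exact ⟨a + b, by rw [PiLp.add_apply, ha, hb]; push_cast; ring⟩

theorem IsIntegralShift.sub {c d : ℝ} {x y : EuclideanSpace ℝ (Fin n)} (hx : IsIntegralShift c x)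
    (hy : IsIntegralShift d y) : IsIntegralShift (c - d) (x - y) := by
  intro i
  obtain ⟨a, ha⟩ := hx i
  obtain ⟨b, hb⟩ := hy i
  exact ⟨a - b, by rw [PiLp.sub_apply, ha, hb]; push_cast; ring⟩

theorem isIntegralShift_single (i : Fin n) : IsIntegralShift 0 (e i) := by
  intro k
  by_cases h : k = i
  · exact ⟨1, by simp [h]⟩
  · exact ⟨0, by simp [h]⟩

theorem isIntegralShift_zero : IsIntegralShift 0 (0 : EuclideanSpace ℝ (Fin n)) :=
  fun _ => ⟨0, by simp⟩

theorem IsIntegralShift.neg {x : EuclideanSpace ℝ (Fin n)} (hx : IsIntegralShift 0 x) :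
    IsIntegralShift 0 (-x) := by
  simpa using isIntegralShift_zero.sub hx

theorem isIntegralShift_of_mem_rootsB {α : EuclideanSpace ℝ (Fin n)} (hα : α ∈ rootsB n) :
    IsIntegralShift 0 α := by
  have he := fun i : Fin n => isIntegralShift_single i
  rcases hα with ⟨i, j, -, rfl | rfl | rfl | rfl⟩ | ⟨i, rfl | rfl⟩
  · simpa using (he i).add (he j)
  · simpa using (he i).sub (he j)
  · simpa using (he i).neg.add (he j)
  · simpa using (he i).neg.sub (he j)
  · exact he i
  · exact (he i).neg

theorem posRootsB_subset_rootsB : posRootsB n ⊆ rootsB n := by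
  rintro α (⟨i, j, hij, rfl | rfl⟩ | ⟨i, rfl⟩)
  · exact Or.inl ⟨i, j, hij, Or.inl rfl⟩
  · exact Or.inl ⟨i, j, hij, Or.inr (Or.inl rfl)⟩
  · exact Or.inr ⟨i, Or.inl rfl⟩

theorem mem_weightLattice_of_isIntegralShift {c : ℝ} (hc : c = 0 ∨ c = 1 / 2)
    {x : EuclideanSpace ℝ (Fin n)} (hx : IsIntegralShift c x) : x ∈ weightLattice (rootsB n) := by
  obtain ⟨d, hd⟩ : ∃ d : ℤ, 2 * c = d := by
    rcases hc with rfl | rfl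
    · exact ⟨0, by simp⟩
    · exact ⟨1, by simp⟩
  choose m hm using hx
  rintro α (⟨i, j, hij, rfl | rfl | rfl | rfl⟩ | ⟨i, rfl | rfl⟩)
  · exact ⟨m i + m j + d, by rw [inner_coroot_add x hij.ne, hm, hm]; push_cast; linarith⟩
  · exact ⟨m i - m j, by rw [inner_coroot_sub x hij.ne, hm, hm]; push_cast; linarith⟩
  · exact ⟨-m i + m j, by rw [inner_coroot_neg_add x hij.ne, hm, hm]; push_cast; linarith⟩
  · exact ⟨-m i - m j - d, by rw [inner_coroot_neg_sub x hij.ne, hm, hm]; push_cast; linarith⟩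
  · exact ⟨2 * m i + d, by rw [inner_coroot_single, hm]; push_cast; linarith⟩
  · exact ⟨-(2 * m i + d), by
      rw [coroot_neg, inner_neg_right, inner_coroot_single, hm]; push_cast; linarith⟩

theorem isIntegralShift_of_mem_weightLattice (hn : 1 ≤ n) {x : EuclideanSpace ℝ (Fin n)}
    (hx : x ∈ weightLattice (rootsB n)) : IsIntegralShift 0 x ∨ IsIntegralShift (1 / 2) x := by
  let o : Fin n := ⟨0, hn⟩
  obtain ⟨m, hm⟩ := hx (e o) (Or.inr ⟨o, Or.inl rfl⟩)
  rw [inner_coroot_single] at hm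
  have hdiff : ∀ i, ∃ k : ℤ, x o - x i = k := by
    intro i
    rcases eq_or_ne o i with rfl | h
    · exact ⟨0, by simp⟩
    · have hlt : o < i := lt_of_le_of_ne (Fin.mk_le_mk.2 (Nat.zero_le _)) h
      obtain ⟨k, hk⟩ := hx (e o - e i) (Or.inl ⟨o, i, hlt, Or.inr (Or.inl rfl)⟩)
      exact ⟨k, by rw [← hk, inner_coroot_sub x h]⟩
  rcases Int.even_or_odd' m with ⟨r, rfl | rfl⟩
  · left
    intro i
    obtain ⟨k, hk⟩ := hdiff i
    exact ⟨r - k, by push_cast at hm ⊢; linarith⟩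
  · right
    intro i
    obtain ⟨k, hk⟩ := hdiff i
    exact ⟨r - k, by push_cast at hm ⊢; linarith⟩

theorem mem_rootLattice_of_isIntegralShift {x : EuclideanSpace ℝ (Fin n)}
    (hx : IsIntegralShift 0 x) : x ∈ rootLattice (rootsB n) := by
  choose m hm using hx
  have hsum : x = ∑ i, m i • e i := by
    ext k
    simp [hm, Pi.single_apply]
  rw [hsum]
  exact sum_mem fun i _ => zsmul_mem
    (AddSubgroup.subset_closure (Or.inr ⟨i, Or.inl rfl⟩) : e i ∈ AddSubgroup.closure (rootsB n)) _

theorem isIntegralShift_of_mem_rootLattice {x : EuclideanSpace ℝ (Fin n)}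
    (hx : x ∈ rootLattice (rootsB n)) : IsIntegralShift 0 x := by
  induction hx using AddSubgroup.closure_induction with
  | mem x hx => exact isIntegralShift_of_mem_rootsB hx
  | zero => exact isIntegralShift_zero
  | add x y _ _ hx hy => simpa using hx.add hy
  | neg x _ hx => exact hx.neg

end Coordinates

/-! ### Weyl orbits: invariants and signed permutations. -/

section Orbits

variable {n : ℕ}

theorem rootReflection_mem_weylOrbit {V : Type*} [NormedAddCommGroup V] [InnerProductSpace ℝ V]
    {Φ : Set V} {α v x : V} (hα : α ∈ Φ) (hx : x ∈ weylOrbit Φ v) :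
    rootReflection α x ∈ weylOrbit Φ v := by
  obtain ⟨w, hw, rfl⟩ := hx
  exact ⟨rootReflection α * w,
    mul_mem (Subgroup.subset_closure (Set.mem_image_of_mem _ hα)) hw, rfl⟩

theorem self_mem_weylOrbit {V : Type*} [NormedAddCommGroup V] [InnerProductSpace ℝ V]
    (Φ : Set V) (v : V) : v ∈ weylOrbit Φ v := ⟨1, one_mem _, rfl⟩

theorem weylOrbit_subset_permutohedron {V : Type*} [NormedAddCommGroup V] [InnerProductSpace ℝ V]
    (Φ : Set V) (v : V) : weylOrbit Φ v ⊆ permutohedron Φ v := subset_convexHull ℝ _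

theorem norm_le_of_mem_permutohedron {V : Type*} [NormedAddCommGroup V] [InnerProductSpace ℝ V]
    {Φ : Set V} {v x : V} (hx : x ∈ permutohedron Φ v) : ‖x‖ ≤ ‖v‖ := by
  have hsub : permutohedron Φ v ⊆ Metric.closedBall 0 ‖v‖ := by
    refine convexHull_min ?_ (convex_closedBall 0 ‖v‖)
    rintro _ ⟨w, -, rfl⟩
    simp
  simpa using hsub hx

theorem isIntegralShift_of_mem_weylOrbit {c : ℝ} (hc : c = 0 ∨ c = 1 / 2)
    {v x : EuclideanSpace ℝ (Fin n)} (hv : IsIntegralShift c v)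
    (hx : x ∈ weylOrbit (rootsB n) v) : IsIntegralShift c x := by
  have hrefl : ∀ α ∈ rootsB n, ∀ y, IsIntegralShift c y →
      IsIntegralShift c (rootReflection α y) := by
    intro α hα y hy
    obtain ⟨m, hm⟩ := mem_weightLattice_of_isIntegralShift hc hy α hα
    have hmul : IsIntegralShift 0 ((m : ℝ) • α) := by
      intro i
      obtain ⟨k, hk⟩ := isIntegralShift_of_mem_rootsB hα i
      exact ⟨m * k, by simp [hk]⟩
    rw [rootReflection_apply, hm]
    simpa using hy.sub hmul
  obtain ⟨w, hw, rfl⟩ := hx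
  -- An equivalence for all `y`, rather than an implication, passes to inverses in the closure
  -- induction.
  have key : ∀ y, IsIntegralShift c y ↔ IsIntegralShift c (w y) := by
    induction hw using Subgroup.closure_induction with
    | mem w hw =>
      obtain ⟨α, hα, rfl⟩ := hw
      refine fun y => ⟨hrefl α hα y, fun h => ?_⟩
      have := hrefl α hα _ h
      rwa [rootReflection, Submodule.reflection_reflection] at this
    | one => exact fun y => Iff.rfl
    | mul a b _ _ ha hb => exact fun y => (hb y).trans (ha (b y))
    | inv a _ ha =>
      intro y
      have := ha (a⁻¹ y)
      rw [show a (a⁻¹ y) = y from a.apply_symm_apply y] at this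
      exact this.symm
  exact (key v).1 hv

theorem rootReflection_single_apply (x : EuclideanSpace ℝ (Fin n)) (i k : Fin n) :
    rootReflection (e i) x k = if k = i then -x k else x k := by
  rw [rootReflection_apply, inner_coroot_single]
  by_cases h : k = i
  · subst h
    simp
    ring
  · simp [h]

theorem rootReflection_sub_apply (x : EuclideanSpace ℝ (Fin n)) {i j : Fin n} (h : i ≠ j)
    (k : Fin n) : rootReflection (e i - e j) x k = x (Equiv.swap i j k) := by
  rw [rootReflection_apply, inner_coroot_sub x h]
  rcases eq_or_ne k i with rfl | hi
  · simp [h]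
  rcases eq_or_ne k j with rfl | hj
  · simp [hi]
  · simp [hi, hj, Equiv.swap_apply_of_ne_of_ne hi hj]

theorem sub_single_mem_rootsB {i j : Fin n} (h : i ≠ j) : e i - e j ∈ rootsB n := by
  rcases lt_or_gt_of_ne h with h | h
  · exact Or.inl ⟨i, j, h, Or.inr (Or.inl rfl)⟩
  · exact Or.inl ⟨j, i, h, Or.inr (Or.inr (Or.inl (by abel)))⟩

theorem perm_mem_weylOrbit (v : EuclideanSpace ℝ (Fin n)) (π : Equiv.Perm (Fin n)) :
    ∀ x ∈ weylOrbit (rootsB n) v,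
      WithLp.toLp 2 (fun i => x (π i)) ∈ weylOrbit (rootsB n) v := by
  induction π using Equiv.Perm.swap_induction_on with
  | one => exact fun x hx => hx
  | swap_mul π i j hij ih =>
    intro x hx
    have := ih _ (rootReflection_mem_weylOrbit (sub_single_mem_rootsB hij) hx)
    convert this using 3 with k
    rw [rootReflection_sub_apply x hij]
    rfl

theorem signFlip_mem_weylOrbit (v : EuclideanSpace ℝ (Fin n)) (s : Finset (Fin n))
    {x : EuclideanSpace ℝ (Fin n)} (hx : x ∈ weylOrbit (rootsB n) v) :
    WithLp.toLp 2 (fun i => if i ∈ s then -x i else x i) ∈ weylOrbit (rootsB n) v := by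
  induction s using Finset.induction_on with
  | empty => simpa using hx
  | insert a s ha ih =>
    have := rootReflection_mem_weylOrbit (α := e a) (Or.inr ⟨a, Or.inl rfl⟩) ih
    convert this using 1
    ext k
    rw [rootReflection_single_apply]
    by_cases h : k = a
    · subst h
      simp [ha]
    · simp [h]

/-- The image of `v` under the signed permutation given by `π` and by the set of flipped signs. -/
def signedPerm (v : EuclideanSpace ℝ (Fin n)) (p : Equiv.Perm (Fin n) × Finset (Fin n)) :
    EuclideanSpace ℝ (Fin n) :=
  WithLp.toLp 2 (fun i => if i ∈ p.2 then -v (p.1 i) else v (p.1 i))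

theorem signedPerm_mem_weylOrbit (v : EuclideanSpace ℝ (Fin n))
    (p : Equiv.Perm (Fin n) × Finset (Fin n)) : signedPerm v p ∈ weylOrbit (rootsB n) v :=
  signFlip_mem_weylOrbit v p.2 (perm_mem_weylOrbit v p.1 v (self_mem_weylOrbit _ v))

end Orbits

/-! ### The minuscule weight `ω_n` and the coordinates of `ρ`. -/

section Minuscule

variable {n : ℕ}

theorem last_fundamentalWeightB_apply (hn : n - 1 < n) (k : Fin n) :
    fundamentalWeightB n ⟨n - 1, hn⟩ k = 1 / 2 := by
  rw [fundamentalWeightB_apply, if_neg (by simp; omega)]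

/-- Points of the permutohedron are no longer than `ω_n`, whose coordinates are all `1/2`. A vector
with half-integer coordinates has every square at least `1/4`, so equality holds throughout and the
vector is a sign change of `ω_n`. -/
theorem isMinuscule_last_fundamentalWeightB (hn : n - 1 < n) :
    IsMinuscule (rootsB n) (simpleRootB n) (fundamentalWeightB n ⟨n - 1, hn⟩) := by
  set ω := fundamentalWeightB n ⟨n - 1, hn⟩ with hω
  have happ : ∀ k, ω k = 1 / 2 := last_fundamentalWeightB_apply hn
  have hint : IsIntegralShift (1 / 2) ω := fun k => ⟨0, by simp [happ]⟩
  refine ⟨?_, mem_weightLattice_of_isIntegralShift (Or.inr rfl) hint, ?_, ?_⟩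
  · intro h
    have := happ ⟨n - 1, hn⟩
    rw [h] at this
    norm_num at this
  · intro j
    rw [(eq_fundamentalWeightB_iff n _ _).1 hω j]
    split_ifs <;> norm_num
  · apply Set.Subset.antisymm
    · rintro x ⟨hx, hxQ⟩
      have hxint : IsIntegralShift (1 / 2) x := by
        simpa using hint.sub (isIntegralShift_of_mem_rootLattice hxQ)
      have hge : ∀ i, (1 / 4 : ℝ) ≤ x i ^ 2 := by
        intro i
        obtain ⟨m, hm⟩ := hxint i
        -- `(m + 1/2)² = m (m + 1) + 1/4`.
        have : (0 : ℝ) ≤ m * (m + 1) := by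
          norm_cast
          rcases le_or_gt 0 m with h | h
          · positivity
          · exact mul_nonneg_of_nonpos_of_nonpos h.le (by omega)
        rw [hm]
        nlinarith
      have hle : ∑ i, x i ^ 2 ≤ ∑ i : Fin n, (1 / 4 : ℝ) := by
        have h := pow_le_pow_left₀ (norm_nonneg _) (norm_le_of_mem_permutohedron hx) 2
        rw [EuclideanSpace.real_norm_sq_eq, EuclideanSpace.real_norm_sq_eq] at h
        refine h.trans_eq (Finset.sum_congr rfl fun i _ => ?_)
        rw [happ]
        norm_num
      have heq : ∀ i, x i ^ 2 = 1 / 4 := fun i =>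
        ((Finset.sum_eq_sum_iff_of_le fun i _ => hge i).1
          (le_antisymm (Finset.sum_le_sum fun i _ => hge i) hle) i (Finset.mem_univ i)).symm
      have := signFlip_mem_weylOrbit ω (Finset.univ.filter fun i => x i < 0)
        (self_mem_weylOrbit _ ω)
      convert this using 1
      ext i
      have hsq : (x i - 1 / 2) * (x i + 1 / 2) = 0 := by linarith [heq i]
      by_cases h : x i < 0
      · simp only [Finset.mem_filter, Finset.mem_univ, true_and, h, if_true, happ]
        rcases mul_eq_zero.1 hsq with h' | h' <;> linarith
      · simp only [Finset.mem_filter, Finset.mem_univ, true_and, h, if_false, happ]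
        rcases mul_eq_zero.1 hsq with h' | h' <;> linarith
    · intro x hx
      refine ⟨weylOrbit_subset_permutohedron _ _ hx, mem_rootLattice_of_isIntegralShift ?_⟩
      simpa using hint.sub (isIntegralShift_of_mem_weylOrbit (Or.inr rfl) hint hx)

theorem weylVectorB_apply (i : Fin n) : weylVectorB n i = n - i - 1 / 2 := by
  have hn : n - 1 < n := by have := i.2; omega
  have hterm : ∀ j : Fin n, fundamentalWeightB n j i =
      (if i ≤ j then 1 else 0) - (if j = ⟨n - 1, hn⟩ then 1 / 2 else 0) := by
    intro j
    have := i.2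
    have := j.2
    rw [fundamentalWeightB_apply]
    simp only [Fin.le_def, Fin.ext_iff]
    split_ifs <;> first | omega | norm_num
  have hsum : weylVectorB n i = ∑ j, fundamentalWeightB n j i := by
    simp [weylVectorB]
  rw [hsum, Finset.sum_congr rfl fun j _ => hterm j, Finset.sum_sub_distrib, Finset.sum_ite_eq',
    if_pos (Finset.mem_univ _), Finset.sum_boole]
  have : (Finset.univ.filter fun j => i ≤ j) = Finset.Ici i := by ext; simp
  rw [this, Fin.card_Ici, Nat.cast_sub i.2.le]

end Minuscule

/-! ### Sign vectors and the excess functional. -/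

section SignVectors

variable {n : ℕ}

/-- The pairing of a sign vector with `x`. -/
def signPairing (σ : Fin n → SignType) (x : EuclideanSpace ℝ (Fin n)) : ℝ := ∑ i, (σ i : ℝ) * x i

/-- The number of nonzero entries of a sign vector, as a real number. -/
def signCount (σ : Fin n → SignType) : ℝ := ∑ i, (σ i : ℝ) ^ 2

/-- The sum of the first `t` terms of the sequence `n - c, n - 1 - c, n - 2 - c, …`. -/
def stairSum (n : ℕ) (c t : ℝ) : ℝ := t * (n - c) - t * (t - 1) / 2

/-- The amount by which `x` exceeds the inequality of the permutohedron of
`(n - c, n - 1 - c, …, 1 - c)` that belongs to the sign vector `σ`. -/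
def excess (c : ℝ) (x : EuclideanSpace ℝ (Fin n)) (σ : Fin n → SignType) : ℝ :=
  signPairing σ x - stairSum n c (signCount σ)

theorem sum_update {ι α : Type*} [Fintype ι] [DecidableEq ι] (F : ι → α → ℝ) (σ : ι → α) (i : ι)
    (s : α) : ∑ k, F k (Function.update σ i s k) = ∑ k, F k (σ k) + (F i s - F i (σ i)) := by
  rw [← Finset.add_sum_erase _ _ (Finset.mem_univ i),
    ← Finset.add_sum_erase (a := i) _ (fun k => F k (σ k)) (Finset.mem_univ i),
    Function.update_self]
  have : ∑ k ∈ Finset.univ.erase i, F k (Function.update σ i s k) =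
      ∑ k ∈ Finset.univ.erase i, F k (σ k) :=
    Finset.sum_congr rfl fun k hk => by rw [Function.update_of_ne (Finset.ne_of_mem_erase hk)]
  rw [this]
  ring

theorem signPairing_update (σ : Fin n → SignType) (x : EuclideanSpace ℝ (Fin n)) (i : Fin n)
    (s : SignType) : signPairing (Function.update σ i s) x =
      signPairing σ x + ((s : ℝ) - (σ i : ℝ)) * x i := by
  rw [signPairing, sum_update (fun k (s : SignType) => (s : ℝ) * x k), signPairing]
  ring

theorem signCount_update (σ : Fin n → SignType) (i : Fin n) (s : SignType) :
    signCount (Function.update σ i s) = signCount σ + ((s : ℝ) ^ 2 - (σ i : ℝ) ^ 2) :=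
  sum_update (fun _ (s : SignType) => (s : ℝ) ^ 2) σ i s

theorem signCount_le (σ : Fin n → SignType) : signCount σ ≤ n := by
  calc signCount σ ≤ ∑ _i : Fin n, (1 : ℝ) := Finset.sum_le_sum fun i _ => by
        cases σ i <;> simp
    _ = n := by simp

theorem signPairing_add (σ : Fin n → SignType) (x y : EuclideanSpace ℝ (Fin n)) :
    signPairing σ (x + y) = signPairing σ x + signPairing σ y := by
  simp [signPairing, mul_add, Finset.sum_add_distrib]

theorem signPairing_sub (σ : Fin n → SignType) (x y : EuclideanSpace ℝ (Fin n)) :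
    signPairing σ (x - y) = signPairing σ x - signPairing σ y := by
  simp [signPairing, mul_sub, Finset.sum_sub_distrib]

theorem signPairing_smul (σ : Fin n → SignType) (a : ℝ) (x : EuclideanSpace ℝ (Fin n)) :
    signPairing σ (a • x) = a * signPairing σ x := by
  simp only [signPairing, Finset.mul_sum, PiLp.smul_apply, smul_eq_mul]
  exact Finset.sum_congr rfl fun i _ => by ring

theorem signPairing_single (σ : Fin n → SignType) (i : Fin n) : signPairing σ (e i) = σ i := by
  simp [signPairing]

theorem signCount_eq_natCast (σ : Fin n → SignType) : ∃ N : ℕ, signCount σ = N := by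
  refine ⟨∑ i, (σ i : ℤ).natAbs, ?_⟩
  rw [signCount, Nat.cast_sum]
  exact Finset.sum_congr rfl fun i _ => by cases σ i <;> simp

end SignVectors

/-! ### Abel summation and staircase sums. -/

section Abel

/-- Abel summation: subtracting the last value of `b` from all of them leaves a shorter sum of the
same kind, plus that value times the full sum of `d`. -/
theorem sum_mul_nonneg_of_antitone {n : ℕ} (b d : Fin n → ℝ) (hb : Antitone b)
    (hb0 : ∀ i, 0 ≤ b i)
    (hd : ∀ k ≤ n, 0 ≤ ∑ i : Fin n, if (i : ℕ) < k then d i else 0) :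
    0 ≤ ∑ i, b i * d i := by
  induction n with
  | zero => simp
  | succ n ih =>
    have h1 := ih (fun i => b i.castSucc - b (Fin.last n)) (fun i => d i.castSucc)
      (fun i j hij => sub_le_sub_right (hb (Fin.castSucc_le_castSucc_iff.2 hij)) _)
      (fun i => sub_nonneg.2 (hb (Fin.le_last _)))
      (fun k hk => by
        have := hd k (by omega)
        rw [Fin.sum_univ_castSucc] at this
        simpa [not_lt.2 hk] using this)
    have h2 := hd (n + 1) le_rfl
    simp only [Fin.is_lt, if_true] at h2
    have h3 := mul_nonneg (hb0 (Fin.last n)) h2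
    rw [Fin.sum_univ_castSucc] at h3 ⊢
    simp only [sub_mul, Finset.sum_sub_distrib, ← Finset.mul_sum] at h1
    linarith

theorem stairSum_natCast (n : ℕ) (c : ℝ) {k : ℕ} (hk : k ≤ n) :
    (∑ i : Fin n, if (i : ℕ) < k then (n - i - c : ℝ) else 0) = stairSum n c k := by
  rw [Fin.sum_univ_eq_sum_range (fun i : ℕ => if i < k then (n - i - c : ℝ) else 0),
    ← Finset.sum_filter]
  have : (Finset.range n).filter (fun i => i < k) = Finset.range k := by
    ext i
    simp
    omega
  rw [this]
  clear this hk
  induction k with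
  | zero => simp [stairSum]
  | succ k ih =>
    rw [Finset.sum_range_succ, ih, stairSum, stairSum]
    push_cast
    ring

end Abel

/-! ### Maximizers of the excess under central firing. -/

section Firing

variable {n : ℕ}

/-- `stairSum` at `N` is `N n - c N - N.choose 2`; its non-integral part `c N` is absorbed by adding
`c` once per nonzero sign, because `2 c` is an integer. -/
theorem excess_integral {c : ℝ} (hc : c = 0 ∨ c = 1 / 2) {x : EuclideanSpace ℝ (Fin n)}
    (hx : IsIntegralShift c x) (σ : Fin n → SignType) : ∃ m : ℤ, excess c x σ = m := by
  obtain ⟨d, hd⟩ : ∃ d : ℤ, 2 * c = d := by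
    rcases hc with rfl | rfl
    · exact ⟨0, by simp⟩
    · exact ⟨1, by simp⟩
  have hterm : ∀ i, ∃ m : ℤ, (σ i : ℝ) * x i + c * (σ i : ℝ) ^ 2 = m := by
    intro i
    obtain ⟨m, hm⟩ := hx i
    cases hσ : σ i
    · exact ⟨0, by simp⟩
    · exact ⟨-m, by simp [hm]⟩
    · exact ⟨m + d, by push_cast; simp [hm]; linarith⟩
  choose m hm using hterm
  obtain ⟨N, hN⟩ := signCount_eq_natCast σ
  have hsum : signPairing σ x + c * signCount σ = ∑ i, (m i : ℝ) := by
    rw [signPairing, signCount, Finset.mul_sum, ← Finset.sum_add_distrib]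
    exact Finset.sum_congr rfl fun i _ => hm i
  refine ⟨∑ i, m i - N * n + N.choose 2, ?_⟩
  rw [excess, stairSum]
  rw [hN] at hsum ⊢
  push_cast
  rw [Nat.cast_choose_two]
  linarith

/-- If two competitors have excess `2 h + 1` in total, one of them has excess at least `h + 1`. -/
theorem exists_excess_ge_of_add {c : ℝ} (hc : c = 0 ∨ c = 1 / 2) {x : EuclideanSpace ℝ (Fin n)}
    (hx : IsIntegralShift c x) {σ σ₁ σ₂ : Fin n → SignType}
    (h : excess c x σ₁ + excess c x σ₂ = 2 * excess c x σ + 1) :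
    ∃ σ', excess c x σ + 1 ≤ excess c x σ' := by
  obtain ⟨a, ha⟩ := excess_integral hc hx σ
  obtain ⟨b, hb⟩ := excess_integral hc hx σ₁
  obtain ⟨d, hd⟩ := excess_integral hc hx σ₂
  rw [ha, hb, hd] at h
  norm_cast at h
  by_cases hab : a + 1 ≤ b
  · exact ⟨σ₁, by rw [ha, hb]; exact_mod_cast hab⟩
  · exact ⟨σ₂, by rw [ha, hd]; norm_cast; omega⟩

theorem excess_update_update (c : ℝ) (x : EuclideanSpace ℝ (Fin n)) (σ : Fin n → SignType)
    {i j : Fin n} (hij : i ≠ j) (s t : SignType) :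
    excess c x (Function.update (Function.update σ i s) j t) =
      signPairing σ x + ((s : ℝ) - (σ i : ℝ)) * x i + ((t : ℝ) - (σ j : ℝ)) * x j -
        stairSum n c (signCount σ + ((s : ℝ) ^ 2 - (σ i : ℝ) ^ 2) +
          ((t : ℝ) ^ 2 - (σ j : ℝ) ^ 2)) := by
  rw [excess, signPairing_update, signCount_update, signPairing_update, signCount_update,
    Function.update_of_ne hij.symm]

/-- Deleting the sign at `i` keeps the pairing, as `x i = 0`, and lowers the staircase sum by its
last term, which is at least `1` because a zero coordinate forces `c = 0`. -/
theorem exists_excess_ge_single {c : ℝ} (hc : c = 0 ∨ c = 1 / 2) {x : EuclideanSpace ℝ (Fin n)}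
    (hx : IsIntegralShift c x) (i : Fin n) (hi : x i = 0) (σ : Fin n → SignType) :
    ∃ σ', excess c x σ + |(σ i : ℝ)| ≤ excess c x σ' := by
  by_cases h0 : σ i = 0
  · exact ⟨σ, by simp [h0]⟩
  have hsq : (σ i : ℝ) ^ 2 = 1 := by
    cases hσ : σ i <;> simp_all
  have habs : |(σ i : ℝ)| = 1 := by
    cases hσ : σ i <;> simp_all
  have hc0 : c = 0 := by
    obtain ⟨m, hm⟩ := hx i
    rcases hc with h | h
    · exact h
    · exfalso
      rw [hi, h] at hm
      have : (2 * m + 1 : ℤ) = 0 := by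
        have : (2 * m + 1 : ℝ) = 0 := by linarith
        exact_mod_cast this
      omega
  refine ⟨Function.update σ i 0, ?_⟩
  have hle := signCount_le σ
  rw [habs, excess, excess, signPairing_update, signCount_update, hsq, hi, stairSum, stairSum, hc0]
  simp
  nlinarith

/-- If one of the two signs vanishes, compare deleting the other with filling the gap so that the
filled sign adds what the deletion removes: the pairings cancel, and the second difference `-1` of
the staircase sum leaves a total gain of `1`. If both signs are nonzero and their combination is not
zero, they contribute nothing to the pairing; deleting both saves at least `(2 - c) + (1 - c) ≥ 2`.
-/
theorem exists_excess_ge_pair {c : ℝ} (hc : c = 0 ∨ c = 1 / 2) {x : EuclideanSpace ℝ (Fin n)}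
    (hx : IsIntegralShift c x) {i j : Fin n} (hij : i ≠ j) {b : SignType} (hb : b ≠ 0)
    (h : x i = -((b : ℝ) * x j)) (σ : Fin n → SignType) :
    ∃ σ', excess c x σ + |(σ i : ℝ) + (b : ℝ) * (σ j : ℝ)| ≤ excess c x σ' := by
  have hle := signCount_le σ
  have hc1 : c ≤ 1 / 2 := by rcases hc with rfl | rfl <;> norm_num
  have hb2 : (b : ℝ) * b = 1 := by cases b <;> simp_all
  have hzero := excess_update_update c x σ hij 0 0
  -- Here and in `hj`, one of the two updates writes the old sign back, only to fit the two-update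
  -- formula.
  have hi := excess_update_update c x σ hij (σ i) (-(b * σ i))
  have hj := excess_update_update c x σ hij (-(b * σ j)) (σ j)
  rcases eq_or_ne (σ i) 0 with hi0 | hi0
  · rcases eq_or_ne (σ j) 0 with hj0 | hj0
    · exact ⟨σ, by simp [hi0, hj0]⟩
    · have habs : |(σ i : ℝ) + (b : ℝ) * (σ j : ℝ)| = 1 := by
        cases hσ : σ j <;> cases b <;> simp_all
      have hsq : (σ j : ℝ) ^ 2 = 1 := by cases hσ : σ j <;> simp_all
      have hsq' : ((-(b * σ j) : SignType) : ℝ) ^ 2 = 1 := by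
        cases hσ : σ j <;> cases b <;> simp_all
      have hcast : ((-(b * σ j) : SignType) : ℝ) = -((b : ℝ) * σ j) := by
        cases hσ : σ j <;> cases b <;> simp
      rw [habs]
      refine exists_excess_ge_of_add hc hx (σ₁ := Function.update (Function.update σ i 0) j 0)
        (σ₂ := Function.update (Function.update σ i (-(b * σ j))) j (σ j)) ?_
      rw [hzero, hj, hsq', hcast, hi0, hsq, h, excess, stairSum, stairSum, stairSum]
      simp
      linear_combination (σ j : ℝ) * x j * hb2
  · rcases eq_or_ne (σ j) 0 with hj0 | hj0
    · have habs : |(σ i : ℝ) + (b : ℝ) * (σ j : ℝ)| = 1 := by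
        cases hσ : σ i <;> cases b <;> simp_all
      have hsq : (σ i : ℝ) ^ 2 = 1 := by cases hσ : σ i <;> simp_all
      have hsq' : ((-(b * σ i) : SignType) : ℝ) ^ 2 = 1 := by
        cases hσ : σ i <;> cases b <;> simp_all
      have hcast : ((-(b * σ i) : SignType) : ℝ) = -((b : ℝ) * σ i) := by
        cases hσ : σ i <;> cases b <;> simp
      rw [habs]
      refine exists_excess_ge_of_add hc hx (σ₁ := Function.update (Function.update σ i 0) j 0)
        (σ₂ := Function.update (Function.update σ i (σ i)) j (-(b * σ i))) ?_
      rw [hzero, hi, hsq', hcast, hj0, hsq, h, excess, stairSum, stairSum, stairSum]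
      simp
      ring
    · by_cases hs : (σ i : ℝ) + (b : ℝ) * (σ j : ℝ) = 0
      · exact ⟨σ, by simp [hs]⟩
      · have habs : |(σ i : ℝ) + (b : ℝ) * (σ j : ℝ)| = 2 := by
          cases hσ : σ i <;> cases hσ' : σ j <;> cases b <;> simp_all <;> norm_num
        have hsq : (σ i : ℝ) ^ 2 = 1 := by cases hσ : σ i <;> simp_all
        have hsq' : (σ j : ℝ) ^ 2 = 1 := by cases hσ : σ j <;> simp_all
        have heq : (σ j : ℝ) = b * σ i := by
          cases hσ : σ i <;> cases hσ' : σ j <;> cases b <;> simp_all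
        refine ⟨Function.update (Function.update σ i 0) j 0, ?_⟩
        rw [hzero, habs, hsq, hsq', heq, h, excess, stairSum, stairSum]
        simp
        nlinarith

theorem exists_excess_ge_of_fires {c : ℝ} (hc : c = 0 ∨ c = 1 / 2) {x : EuclideanSpace ℝ (Fin n)}
    (hx : IsIntegralShift c x) {α : EuclideanSpace ℝ (Fin n)} (hα : α ∈ posRootsB n)
    (h : ⟪x, coroot α⟫_ℝ = 0) (σ : Fin n → SignType) :
    ∃ σ', excess c x σ + |signPairing σ α| ≤ excess c x σ' := by
  rcases hα with ⟨i, j, hij, rfl | rfl⟩ | ⟨i, rfl⟩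
  · rw [inner_coroot_add x hij.ne] at h
    have := exists_excess_ge_pair hc hx hij.ne (b := 1) (by decide) (by simp; linarith) σ
    simpa [signPairing_add, signPairing_single] using this
  · rw [inner_coroot_sub x hij.ne] at h
    have := exists_excess_ge_pair hc hx hij.ne (b := -1) (by decide) (by simp; linarith) σ
    rw [signPairing_sub, signPairing_single, signPairing_single]
    simpa [← sub_eq_add_neg] using this
  · rw [inner_coroot_single] at h
    simpa [signPairing_single] using exists_excess_ge_single hc hx i (by linarith) σ

/-- A maximizer of the excess stays one along central-firing moves, and its pairing with the
weight is invariant. -/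
theorem excess_maximizer_invariant {c : ℝ} (hc : c = 0 ∨ c = 1 / 2)
    {x y : EuclideanSpace ℝ (Fin n)} (hx : IsIntegralShift c x) {τ : Fin n → SignType}
    (hτ : ∀ σ, excess c x σ ≤ excess c x τ)
    (hy : Relation.ReflTransGen (CentralFires (posRootsB n)) x y) :
    IsIntegralShift c y ∧ (∀ σ, excess c y σ ≤ excess c y τ) ∧
      signPairing τ y = signPairing τ x := by
  induction hy with
  | refl => exact ⟨hx, hτ, rfl⟩
  | tail _ hfire ih =>
    obtain ⟨α, hα, horth, rfl⟩ := hfire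
    obtain ⟨hint, hmax, hpair⟩ := ih
    have hbound := fun σ => exists_excess_ge_of_fires hc hint hα horth σ
    have hτα : signPairing τ α = 0 := by
      obtain ⟨σ', h'⟩ := hbound τ
      exact abs_eq_zero.1 (le_antisymm (by linarith [hmax σ']) (abs_nonneg _))
    refine ⟨?_, fun σ => ?_, by rw [signPairing_add, hτα, hpair, add_zero]⟩
    · simpa using hint.add (isIntegralShift_of_mem_rootsB (posRootsB_subset_rootsB hα))
    · obtain ⟨σ', h'⟩ := hbound σ
      have h1 := hmax σ'
      have h2 := le_abs_self (signPairing σ α)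
      simp only [excess, signPairing_add, hτα] at *
      linarith

theorem eq_zero_of_maximizer_of_isConnectedWeight {c : ℝ} (hc : c = 0 ∨ c = 1 / 2)
    {x : EuclideanSpace ℝ (Fin n)} (hx : IsIntegralShift c x)
    (hconn : IsConnectedWeight (posRootsB n) x) {τ : Fin n → SignType}
    (hτ : ∀ σ, excess c x σ ≤ excess c x τ) : τ = 0 := by
  let φ : EuclideanSpace ℝ (Fin n) →ₗ[ℝ] ℝ :=
    { toFun := signPairing τ
      map_add' := signPairing_add τ
      map_smul' := fun a y => by simpa using signPairing_smul τ a y }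
  have hle : firingSpan (posRootsB n) x ≤ LinearMap.ker φ := by
    refine Submodule.span_le.2 ?_
    rintro _ ⟨μ, hμ, rfl⟩
    change signPairing τ (x - μ) = 0
    rw [signPairing_sub, (excess_maximizer_invariant hc hx hτ hμ).2.2, sub_self]
  rw [show firingSpan (posRootsB n) x = ⊤ from hconn] at hle
  funext i
  have h0 : signPairing τ (e i) = 0 := hle (Submodule.mem_top : e i ∈ ⊤)
  rw [signPairing_single] at h0
  cases hσ : τ i <;> simp_all

theorem excess_neg_of_isConnectedWeight {c : ℝ} (hc : c = 0 ∨ c = 1 / 2)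
    {x : EuclideanSpace ℝ (Fin n)} (hx : IsIntegralShift c x)
    (hconn : IsConnectedWeight (posRootsB n) x) {σ : Fin n → SignType} (hσ : σ ≠ 0) :
    excess c x σ < 0 := by
  obtain ⟨τ, hτ⟩ := Finite.exists_max (excess c x)
  have hτ0 := eq_zero_of_maximizer_of_isConnectedWeight hc hx hconn hτ
  have hzero : excess c x (0 : Fin n → SignType) = 0 := by
    simp [excess, signPairing, signCount, stairSum]
  have hle := hτ σ
  rw [hτ0, hzero] at hle
  -- A nonzero `σ` of excess `0` would be a second maximizer.
  refine lt_of_le_of_ne hle fun heq => hσ ?_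
  refine eq_zero_of_maximizer_of_isConnectedWeight hc hx hconn fun σ' => ?_
  rw [heq, ← hzero, ← hτ0]
  exact hτ σ'

end Firing

/-! ### From the sign inequalities to the permutohedron and its interior. -/

section Permutohedron

variable {n : ℕ}

/-- The point `(n - c, n - 1 - c, …, 1 - c)`. -/
def stairVector (n : ℕ) (c : ℝ) : EuclideanSpace ℝ (Fin n) :=
  WithLp.toLp 2 (fun i : Fin n => (n : ℝ) - (i : ℕ) - c)

/-- Rearrangement: the vertex whose entries match the order of the `|y i|` and the signs of `y`
dominates `x` in the direction `y`, since the sign inequalities bound every partial sum needed for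
Abel summation. -/
theorem exists_signedPerm_ge {c : ℝ} {x : EuclideanSpace ℝ (Fin n)}
    (hx : ∀ σ : Fin n → SignType, excess c x σ ≤ 0) (y : Fin n → ℝ) :
    ∃ p, ∑ i, x i * y i ≤ ∑ i, signedPerm (stairVector n c) p i * y i := by
  set π := Tuple.sort (fun i => -|y i|) with hπ
  have hmono := Tuple.monotone_sort (fun i => -|y i|)
  rw [← hπ] at hmono
  -- The sign at a zero of `y` is taken to be `1`, so that `ε` has no zero entries and the count
  -- below is exactly `k`.
  let ε : Fin n → SignType := fun i => if y i < 0 then -1 else 1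
  have hε : ∀ i, (ε i : ℝ) * |y i| = y i := by
    intro i
    by_cases h : y i < 0
    · simp [ε, h, abs_of_neg h]
    · simp [ε, h, abs_of_nonneg (not_lt.1 h)]
  have hε2 : ∀ i, (ε i : ℝ) ^ 2 = 1 := by
    intro i
    by_cases h : y i < 0 <;> simp [ε, h]
  refine ⟨(π⁻¹, Finset.univ.filter fun i => y i < 0), ?_⟩
  have key := sum_mul_nonneg_of_antitone (fun i => |y (π i)|)
    (fun i => ((n : ℝ) - (i : ℕ) - c) - (ε (π i) : ℝ) * x (π i))
    (fun i j hij => neg_le_neg_iff.1 (hmono hij)) (fun i => abs_nonneg _) (by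
      intro k hk
      -- The signs of `y` on the `k` positions where `|y|` is largest.
      let σ : Fin n → SignType := fun i => if ((π⁻¹ i : Fin n) : ℕ) < k then ε i else 0
      have hcount : signCount σ = k := by
        rw [signCount, ← Equiv.sum_comp π]
        have : ∀ i : Fin n, ((σ (π i) : SignType) : ℝ) ^ 2 = if (i : ℕ) < k then 1 else 0 := by
          intro i
          by_cases h : (i : ℕ) < k <;> simp [σ, h, hε2]
        rw [Finset.sum_congr rfl fun i _ => this i, Finset.sum_boole, Fin.card_filter_val_lt,
          min_eq_right hk]
      have hpair : signPairing σ x =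
          ∑ i : Fin n, if (i : ℕ) < k then (ε (π i) : ℝ) * x (π i) else 0 := by
        rw [signPairing, ← Equiv.sum_comp π]
        refine Finset.sum_congr rfl fun i _ => ?_
        by_cases h : (i : ℕ) < k <;> simp [σ, h]
      have h := hx σ
      rw [excess, hcount, hpair, ← stairSum_natCast n c hk, ← Finset.sum_sub_distrib] at h
      have h' := neg_nonneg.2 h
      rw [← Finset.sum_neg_distrib] at h'
      refine h'.trans_eq (Finset.sum_congr rfl fun i _ => ?_)
      split_ifs <;> ring)
  simp only [mul_sub, Finset.sum_sub_distrib] at key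
  have hxy : ∑ i, x i * y i = ∑ i, |y (π i)| * ((ε (π i) : ℝ) * x (π i)) := by
    rw [← Equiv.sum_comp π]
    exact Finset.sum_congr rfl fun i _ => by
      linear_combination -(x (π i)) * hε (π i)
  have hw : ∑ i, signedPerm (stairVector n c) (π⁻¹, Finset.univ.filter fun i => y i < 0) i * y i =
      ∑ i, |y (π i)| * ((n : ℝ) - (i : ℕ) - c) := by
    rw [← Equiv.sum_comp π]
    refine Finset.sum_congr rfl fun i _ => ?_
    by_cases h : y (π i) < 0
    · simp [signedPerm, stairVector, h, abs_of_neg h]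
      ring
    · simp [signedPerm, stairVector, h, abs_of_nonneg (not_lt.1 h)]
      ring
  rw [hxy, hw]
  simp only [mul_sub, Finset.sum_sub_distrib] at key ⊢
  linarith

theorem mem_permutohedron_of_excess_nonpos {c : ℝ} {x : EuclideanSpace ℝ (Fin n)}
    (hx : ∀ σ : Fin n → SignType, excess c x σ ≤ 0) :
    x ∈ permutohedron (rootsB n) (stairVector n c) := by
  have hsub : convexHull ℝ (Set.range (signedPerm (stairVector n c))) ⊆
      permutohedron (rootsB n) (stairVector n c) :=
    convexHull_mono (Set.range_subset_iff.2 (signedPerm_mem_weylOrbit _))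
  refine hsub ?_
  by_contra hnot
  obtain ⟨f, u, hlt, hgt⟩ := geometric_hahn_banach_closed_point
    (convex_convexHull ℝ (Set.range (signedPerm (stairVector n c))))
    ((Set.finite_range _).isClosed_convexHull ℝ) hnot
  have hf : ∀ z : EuclideanSpace ℝ (Fin n), f z = ∑ i, z i * f (e i) := by
    intro z
    have hz : z = ∑ i, z i • e i := by
      ext k
      simp [Pi.single_apply]
    conv_lhs => rw [hz]
    simp
  obtain ⟨p, hp⟩ := exists_signedPerm_ge hx fun i => f (e i)
  rw [← hf, ← hf] at hp
  have := hlt _ (subset_convexHull ℝ _ (Set.mem_range_self p))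
  linarith

theorem mem_interior_permutohedron_of_excess_neg {c : ℝ} {x : EuclideanSpace ℝ (Fin n)}
    (hx : ∀ σ : Fin n → SignType, σ ≠ 0 → excess c x σ < 0) :
    x ∈ interior (permutohedron (rootsB n) (stairVector n c)) := by
  -- The finitely many strict inequalities define an open neighbourhood; `σ = 0` is left out because
  -- its excess is identically `0`.
  refine mem_interior.2 ⟨⋂ σ : {σ : Fin n → SignType // σ ≠ 0}, {y | excess c y σ < 0}, ?_, ?_, ?_⟩
  · intro y hy
    refine mem_permutohedron_of_excess_nonpos fun σ => ?_
    by_cases hσ : σ = 0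
    · subst hσ
      simp [excess, signPairing, signCount, stairSum]
    · exact (Set.mem_iInter.1 hy ⟨σ, hσ⟩ : excess c y σ < 0).le
  · refine isOpen_iInter_of_finite fun σ => isOpen_lt ?_ continuous_const
    unfold excess signPairing
    fun_prop
  · exact Set.mem_iInter.2 fun σ => hx σ σ.2

theorem mem_permutohedronInteriorPoints_stairVector {c : ℝ} (hc : c = 0 ∨ c = 1 / 2)
    {x : EuclideanSpace ℝ (Fin n)} (hx : IsIntegralShift c x)
    (hconn : IsConnectedWeight (posRootsB n) x) :
    ∀ y, y = stairVector n c → IsIntegralShift c y →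
      x ∈ permutohedronInteriorPoints (rootsB n) y := by
  rintro y rfl hy
  refine ⟨mem_interior_permutohedron_of_excess_neg fun σ hσ =>
    excess_neg_of_isConnectedWeight hc hx hconn hσ, mem_rootLattice_of_isIntegralShift ?_⟩
  simpa using hx.sub hy

end Permutohedron

end CentralFiring

end

theorem mainTheorem9 (n : ℕ) (hn : 1 ≤ n) (v : EuclideanSpace ℝ (Fin n))
    (hv : v ∈ CentralFiring.weightLattice (CentralFiring.rootsB n))
    (hconn : CentralFiring.IsConnectedWeight (CentralFiring.posRootsB n) v) :
    ∃ ω ∈ CentralFiring.zeroOrMinuscule (CentralFiring.rootsB n) (CentralFiring.simpleRootB n),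
      (ω = 0 ∨ ω = CentralFiring.fundamentalWeightB n ⟨n - 1, by omega⟩) ∧
      v ∈ CentralFiring.permutohedronInteriorPoints (CentralFiring.rootsB n)
        (CentralFiring.weylVectorB n + ω) := by
  open CentralFiring in
  have hn' : n - 1 < n := Nat.sub_lt hn one_pos
  rcases isIntegralShift_of_mem_weightLattice hn hv with h | h
  -- The coordinates of `ρ` are half-integers, so integral weights need the shift by `ω_n`, and
  -- half-integral ones take `ω = 0`.
  · refine ⟨_, Or.inr (isMinuscule_last_fundamentalWeightB hn'), Or.inr rfl,
      mem_permutohedronInteriorPoints_stairVector (Or.inl rfl) h hconn _ ?_ fun i => ?_⟩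
    · ext i
      simp [weylVectorB_apply, last_fundamentalWeightB_apply hn', stairVector]
    · exact ⟨n - i, by simp [weylVectorB_apply, last_fundamentalWeightB_apply hn']⟩
  · refine ⟨0, Or.inl rfl, Or.inl rfl,
      mem_permutohedronInteriorPoints_stairVector (Or.inr rfl) h hconn _ ?_ fun i => ?_⟩
    · ext i
      simp [weylVectorB_apply, stairVector]
    · exact ⟨n - i - 1, by simp [weylVectorB_apply]; ring⟩
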